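/- Let $k$ be an infinite field, let $n\in\mathbb N$, and let $S=\bigoplus_{a\in\mathbb N^n}S_a$ be a commutative $\mathbb N^n$-graded $k$-algebra. Write $S^{(i)}:=S_{e_i}$, where $e_i$ is the $i$-th standard basis vector of $\mathbb N^n$. Assume that $S$ is *standard*, that is, $S_{(0,\dots,0)}=k$ and $S$ is generated as a $k$-algebra by $S^{(1)}\cup\dots\cup S^{(n)}$. Let $S^\Delta:=k[S_{(1,\dots,1)}]\subseteq S$ be its diagonal subring. A *complete reduction of $S$ of type $r$* is an $n\times r$ matrix $\{x_{ij}\}$ with $x_{ij}\in S^{(i)}$ for all $i,j$ such that, setting $X_j:=\prod_{i=1}^n x_{ij}$ for $1\le j\le r$, the ring $S^\Delta$ is module-finite over its subring $k[X_1,\dots,X_r]$. Suppose that the Krull dimension $d:=\dim S^\Delta$ is finite with $d\ge 1$, and that $\{x_{ij}\}$ and $\{w_{ij}\}$ $(1\le i\le n,\ 1\le j\le d)$ are complete reductions of $S$ of type $d$. Then there is a proper Zariski-closed subset $M\subsetneq k^{n\times d}$ (the set of common zeros in $k^{n\times d}$ of a set of polynomials over $k$ in $nd$ variables) such that for every $C=\{c_{ij}\}\in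 k^{n\times d}$ we have $C\notin M$ if and only if $\{x^C_{ij}\}$ is a complete reduction of $S$ (of type $d$), where \[ x^C_{ij}:=\begin{cases} x_{ij} & \text{if } j<d,\\ \sum_{h=1}^d c_{ih}w_{ih} & \text{if } j=d.\end{cases} \] -/

import Mathlib

/-- An `ℕⁿ`-graded commutative `k`-algebra `S = ⨁ 𝒜 a` is *standard* if the structure map identifies
`k` with the component of degree `(0, …, 0)`, and `S` is generated as a `k`-algebra by the components
whose degrees are the standard basis vectors of `ℕⁿ`. -/
structure IsStandardGraded {k S : Type*} [Field k] [CommRing S] [Algebra k S] {n : ℕ}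
    (𝒜 : (Fin n → ℕ) → Submodule k S) [GradedAlgebra 𝒜] : Prop where
  degree_zero : Function.Bijective (algebraMap k (𝒜 0))
  generated : Algebra.adjoin k (⋃ i : Fin n, (𝒜 (Pi.single i 1) : Set S)) = ⊤

/-- The diagonal subring `k[S_(1, …, 1)]` of an `ℕⁿ`-graded `k`-algebra. -/
def diagonalSubring {k S : Type*} [Field k] [CommRing S] [Algebra k S] {n : ℕ}
    (𝒜 : (Fin n → ℕ) → Submodule k S) : Subalgebra k S :=
  Algebra.adjoin k (𝒜 1 : Set S)

/-- A product of elements of the components `S^(1), …, S^(n)`, one from each, lies in the diagonal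
subring. -/
theorem prod_mem_diagonalSubring {k S : Type*} [Field k] [CommRing S] [Algebra k S] {n : ℕ}
    (𝒜 : (Fin n → ℕ) → Submodule k S) [GradedAlgebra 𝒜]
    (y : ∀ i : Fin n, 𝒜 (Pi.single i 1)) : ∏ i, (y i : S) ∈ diagonalSubring 𝒜 := by
  apply Algebra.subset_adjoin
  have h := SetLike.prod_mem_graded (A := 𝒜) (fun i : Fin n => Pi.single i 1)
    (fun i => (y i : S)) (F := Finset.univ) (fun i _ => (y i).2)
  have e : (∑ i : Fin n, (Pi.single i 1 : Fin n → ℕ)) = 1 :=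
    Finset.univ_sum_single (1 : Fin n → ℕ)
  rw [e] at h
  exact h

/-- The product `X_j = ∏ i, x_ij` of the entries of the `j`-th column, as an element of the diagonal
subring. -/
def columnProd {k S : Type*} [Field k] [CommRing S] [Algebra k S] {n r : ℕ}
    (𝒜 : (Fin n → ℕ) → Submodule k S) [GradedAlgebra 𝒜]
    (x : ∀ i : Fin n, Fin r → 𝒜 (Pi.single i 1)) (j : Fin r) : diagonalSubring 𝒜 :=
  ⟨∏ i, (x i j : S), prod_mem_diagonalSubring 𝒜 fun i => x i j⟩

/-- The `n × r` matrix `x`, with entries `x_ij` in `S^(i)`, is a *complete reduction* (of type `r`) of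
the graded algebra if the diagonal subring is module-finite over its subring `k[X_1, …, X_r]`. -/
def IsCompleteReduction {k S : Type*} [Field k] [CommRing S] [Algebra k S] {n r : ℕ}
    (𝒜 : (Fin n → ℕ) → Submodule k S) [GradedAlgebra 𝒜]
    (x : ∀ i : Fin n, Fin r → 𝒜 (Pi.single i 1)) : Prop :=
  Module.Finite (Algebra.adjoin k (Set.range (columnProd 𝒜 x))) (diagonalSubring 𝒜)

/-- The matrix obtained from `x` by replacing its last column by the column whose `i`-th entry is
`∑ h, c_ih w_ih`. -/
def exchangeLast {k S : Type*} [Field k] [CommRing S] [Algebra k S] {n d : ℕ}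
    (𝒜 : (Fin n → ℕ) → Submodule k S)
    (x w : ∀ i : Fin n, Fin d → 𝒜 (Pi.single i 1)) (C : Fin n × Fin d → k) :
    ∀ i : Fin n, Fin d → 𝒜 (Pi.single i 1) :=
  fun i j => if (j : ℕ) + 1 < d then x i j else ∑ h : Fin d, C (i, h) • w i h

/-- Zariski-closed subsets of the affine space `k^σ`: common zero sets of polynomials over `k`. -/
def IsZariskiClosed {k σ : Type*} [Field k] (M : Set (σ → k)) : Prop :=
  ∃ I : Ideal (MvPolynomial σ k), M = MvPolynomial.zeroLocus k I

/-! Write `A` for the diagonal subring. For `n > 0`, graded Nakayama turns complete reduction into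
finite-dimensionality over `k` of `A` modulo the column products
(`isCompleteReduction_iff_finite_quotient`). Let `J` be generated by all `X_j` but the last. Then `A
⧸ J` is finite over the algebra generated by one element, so `A ⧸ P` has dimension at most one for
each minimal prime `P` of `J`. Hence a new last product `y` works iff it avoids the finitely many
such `P` with `A ⧸ P` infinite-dimensional (`finite_quotient_sup_span_singleton_iff`). Since `y` is
polynomial in `C`, each condition `y ∈ P` is Zariski closed. It is proper: otherwise `P` would
contain every column product of `w`, and `A ⧸ P` would be finite over `k`. As `k` is infinite, the
union of these closed sets is proper; it is `M`. -/

/-- Module-finiteness over a subalgebra generated by a set passes to quotient algebras. -/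
theorem Module.Finite.of_adjoin_of_surjective {k A B : Type*} [CommRing k] [CommRing A]
    [CommRing B] [Algebra k A] [Algebra k B] {s : Set A} [Module.Finite (Algebra.adjoin k s) A]
    (f : A →ₐ[k] B) (hf : Function.Surjective f) (T : Subalgebra k B) (h : ∀ a ∈ s, f a ∈ T) :
    Module.Finite T B := by
  classical
  obtain ⟨G, hG⟩ := (Module.Finite.fg_top : (⊤ : Submodule (Algebra.adjoin k s) A).FG)
  have hT : Algebra.adjoin k s ≤ T.comap f := Algebra.adjoin_le h
  refine ⟨⟨G.image f, eq_top_iff.2 fun b _ => ?_⟩⟩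
  obtain ⟨a, rfl⟩ := hf b
  have ha : a ∈ Submodule.span (Algebra.adjoin k s) (G : Set A) := hG ▸ Submodule.mem_top
  clear * - ha hT
  induction ha using Submodule.span_induction with
  | mem x hx => exact Submodule.subset_span (by simpa using ⟨x, hx, rfl⟩)
  | zero => simp
  | add x y _ _ hx hy => rw [map_add]; exact add_mem hx hy
  | smul r x _ hx =>
    rw [Subalgebra.smul_def, smul_eq_mul, map_mul]
    exact Submodule.smul_mem _ (⟨f r, hT r.2⟩ : T) hx

/-- If `A` is finite over the subalgebra generated by `s`, then its quotient by an ideal containing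
`s` is finite over the base ring. -/
theorem Module.Finite.quotient_of_adjoin {k A : Type*} [CommRing k] [CommRing A] [Algebra k A]
    {s : Set A} [Module.Finite (Algebra.adjoin k s) A] {P : Ideal A} (h : s ⊆ P) :
    Module.Finite k (A ⧸ P) := by
  have : Module.Finite (⊥ : Subalgebra k (A ⧸ P)) (A ⧸ P) :=
    .of_adjoin_of_surjective (s := s) (Ideal.Quotient.mkₐ k P) (Ideal.Quotient.mkₐ_surjective k P) ⊥
      fun a ha => by
        have : Ideal.Quotient.mkₐ k P a = 0 := Ideal.Quotient.eq_zero_iff_mem.2 (h ha)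
        rw [this]; exact zero_mem _
  have : Module.Finite k (⊥ : Subalgebra k (A ⧸ P)) :=
    Module.Finite.of_surjective (Algebra.linearMap k (⊥ : Subalgebra k (A ⧸ P))) fun x => by
      obtain ⟨c, hc⟩ := Algebra.mem_bot.1 x.2
      exact ⟨c, Subtype.ext hc⟩
  exact Module.Finite.trans (⊥ : Subalgebra k (A ⧸ P)) (A ⧸ P)

/-- **Graded Nakayama lemma**: a graded algebra is finite over the subalgebra generated by finitely
many elements of degree one as soon as the quotient by these elements is finite over the base. -/
theorem finite_adjoin_range_of_finite_quotient {k A ι : Type*} [CommRing k] [CommRing A]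
    [Algebra k A] [Finite ι] (𝒟 : ℕ → Submodule k A) [GradedAlgebra 𝒟] {Y : ι → A}
    (hY : ∀ j, Y j ∈ 𝒟 1) [Module.Finite k (A ⧸ Ideal.span (Set.range Y))] :
    Module.Finite (Algebra.adjoin k (Set.range Y)) A := by
  classical
  cases nonempty_fintype ι
  set I := Ideal.span (Set.range Y)
  set T := Algebra.adjoin k (Set.range Y)
  obtain ⟨F, hF⟩ := (Module.Finite.fg_top : (⊤ : Submodule k (A ⧸ I)).FG)
  let G : Finset A := F.image (Function.surjInv Ideal.Quotient.mk_surjective)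
  -- Homogeneous components of the lifts, so that the induction on degree stays within their span.
  let G' : Finset A := G.biUnion fun g =>
    (DirectSum.decompose 𝒟 g).support.image fun m => (DirectSum.decompose 𝒟 g m : A)
  set N := Submodule.span T (G' : Set A)
  have hGN : ∀ g ∈ G, ∀ m, (DirectSum.decompose 𝒟 g m : A) ∈ N := by
    intro g hg m
    by_cases hm : m ∈ (DirectSum.decompose 𝒟 g).support
    · exact Submodule.subset_span
        (Finset.mem_coe.2 (Finset.mem_biUnion.2 ⟨g, hg, Finset.mem_image_of_mem _ hm⟩))
    · rw [DFinsupp.notMem_support_iff.1 hm]; exact N.zero_mem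
  have hspan : ∀ u ∈ Submodule.span k (G : Set A), ∀ m, (DirectSum.decompose 𝒟 u m : A) ∈ N := by
    intro u hu m
    induction hu using Submodule.span_induction with
    | mem x hx => exact hGN x hx m
    | zero => simp
    | add x y _ _ hx hy => simpa [DirectSum.decompose_add] using add_mem hx hy
    | smul r x _ hx =>
      have : (DirectSum.decompose 𝒟 (r • x) m : A)
          = (algebraMap k T r) • (DirectSum.decompose 𝒟 x m : A) := by
        rw [DirectSum.decompose_smul, algebraMap_smul]; rfl
      rw [this]; exact N.smul_mem _ hx
  have hdec : ∀ b : A, ∃ u ∈ Submodule.span k (G : Set A), ∃ v ∈ I, b = u + v := by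
    intro b
    have hb : Ideal.Quotient.mk I b ∈ Submodule.span k (F : Set (A ⧸ I)) := hF ▸ Submodule.mem_top
    have himg : (Ideal.Quotient.mkₐ k I).toLinearMap '' (G : Set A) = F := by
      ext z
      simp only [G, Finset.coe_image, Set.mem_image, Finset.mem_coe, exists_exists_and_eq_and]
      constructor
      · rintro ⟨y, hy, rfl⟩
        simpa [Function.surjInv_eq] using hy
      · intro hz
        exact ⟨z, hz, Function.surjInv_eq Ideal.Quotient.mk_surjective z⟩
    rw [← himg, Submodule.span_image] at hb
    obtain ⟨u, hu, hub⟩ := hb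
    refine ⟨u, hu, b - u, ?_, by ring⟩
    rw [← Ideal.Quotient.eq_zero_iff_mem, map_sub, ← hub]
    exact sub_self _
  have hhom : ∀ m, ∀ b ∈ 𝒟 m, b ∈ N := by
    intro m
    induction m using Nat.strong_induction_on with
    | _ m ih =>
      intro b hb
      obtain ⟨u, hu, v, hv, rfl⟩ := hdec b
      have hm : (DirectSum.decompose 𝒟 (u + v) m : A) = u + v :=
        DirectSum.decompose_of_mem_same 𝒟 hb
      rw [← hm, DirectSum.decompose_add, DirectSum.add_apply, Submodule.coe_add]
      refine add_mem (hspan u hu m) ?_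
      obtain ⟨c, rfl⟩ := Ideal.mem_span_range_iff_exists_fun.1 hv
      rw [DirectSum.decompose_sum, DFinsupp.finsetSum_apply, AddSubmonoidClass.coe_finsetSum]
      refine sum_mem fun j _ => ?_
      by_cases h1 : 1 ≤ m
      -- Since `Y j` has degree one, only the component of `c j` of degree `m - 1` contributes.
      · rw [DirectSum.coe_decompose_mul_of_right_mem_of_le 𝒟 (hY j) h1, mul_comm]
        exact N.smul_mem (⟨Y j, Algebra.subset_adjoin ⟨j, rfl⟩⟩ : T)
          (ih (m - 1) (by omega) _ (SetLike.coe_mem _))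
      · rw [DirectSum.coe_decompose_mul_of_right_mem_of_not_le 𝒟 (hY j) h1]
        exact N.zero_mem
  refine ⟨⟨G', eq_top_iff.2 fun b _ => ?_⟩⟩
  rw [← DirectSum.sum_support_decompose 𝒟 b]
  exact sum_mem fun m _ => hhom m _ (SetLike.coe_mem _)

/-! ### Cutting down a one-dimensional quotient -/

/-- A domain that is finite over a subalgebra generated by one element over a field has dimension
at most one. -/
theorem Ring.DimensionLEOne.of_finite_adjoin_singleton {k K : Type*} [Field k] [CommRing K]
    [IsDomain K] [Algebra k K] (t : K) [Module.Finite (Algebra.adjoin k {t}) K] :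
    Ring.DimensionLEOne K := by
  refine ⟨fun {Q} hQ hQp => ?_⟩
  let g : Polynomial k →+* Algebra.adjoin k {t} :=
    (Polynomial.aeval (⟨t, Algebra.self_mem_adjoin_singleton k t⟩ : Algebra.adjoin k {t})).toRingHom
  have hg : Function.Surjective g := by
    rintro ⟨b, hb⟩
    rw [Algebra.adjoin_singleton_eq_range_aeval] at hb
    obtain ⟨p, rfl⟩ := hb
    refine ⟨p, Subtype.ext ?_⟩
    change (Algebra.adjoin k {t}).val (Polynomial.aeval _ p) = _
    rw [← Polynomial.aeval_algHom_apply]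
    rfl
  let f : Polynomial k →+* K := (algebraMap (Algebra.adjoin k {t}) K).comp g
  have hf : f.IsIntegral := RingHom.IsIntegral.trans _ _ (RingHom.isIntegral_of_surjective _ hg)
    (algebraMap_isIntegral_iff.2 inferInstance)
  obtain ⟨q, hqQ, hq⟩ := Submodule.exists_mem_ne_zero_of_ne_bot hQ
  let _ := f.toAlgebra
  -- `f` need not be injective; strict growth over its kernel already makes the contraction of `Q` a
  -- nonzero prime of `k[X]`, hence maximal.
  have hlt : (⊥ : Ideal K).comap f < Q.comap f :=
    Ideal.comap_lt_comap_of_integral_mem_sdiff (R := Polynomial k) bot_le ⟨hqQ, by simpa using hq⟩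
      (hf q)
  have : (Q.comap f).IsPrime := Ideal.comap_isPrime f Q
  exact Ideal.isMaximal_of_isIntegral_of_isMaximal_comap' f hf Q
    (IsPrime.to_maximal_ideal (ne_bot_of_gt hlt))

/-- Suppose that `A ⧸ J` is finite over the subalgebra generated by one element. Then cutting down
by `y` gives a finite-dimensional algebra if and only if `y` avoids every minimal prime of `J` with
infinite-dimensional quotient. -/
theorem finite_quotient_sup_span_singleton_iff {k A : Type*} [Field k] [CommRing A] [Algebra k A]
    [Algebra.FiniteType k A] {J : Ideal A} (t : A ⧸ J)
    [Module.Finite (Algebra.adjoin k {t}) (A ⧸ J)] (y : A) :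
    Module.Finite k (A ⧸ (J ⊔ Ideal.span {y})) ↔
      ∀ P ∈ J.minimalPrimes, ¬ Module.Finite k (A ⧸ P) → y ∉ P := by
  constructor
  · intro _ P hP hPf hy
    have hle : J ⊔ Ideal.span {y} ≤ P := sup_le hP.1.2 (by simpa [Ideal.span_le] using hy)
    exact hPf (Module.Finite.of_surjective (Ideal.Quotient.factorₐ k hle).toLinearMap
      (Ideal.Quotient.factor_surjective hle))
  · intro h
    rw [Module.finite_iff_krullDimLE_zero,
      Ideal.krullDimLE_zero_quotient_iff_forall_minimalPrimes_isMaximal]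
    intro Q hQ
    have hQp : Q.IsPrime := hQ.1.1
    obtain ⟨P, hP, hPQ⟩ := Ideal.exists_minimalPrimes_le (le_sup_left.trans hQ.1.2)
    have hPp : P.IsPrime := hP.1.1
    -- Either `P` is maximal and equals `Q`, or `y ∈ Q \ P` makes `Q / P` a nonzero prime of a
    -- domain of dimension at most one.
    by_cases hfin : Module.Finite k (A ⧸ P)
    · have : IsArtinianRing (A ⧸ P) := (Module.finite_iff_isArtinianRing k (A ⧸ P)).1 hfin
      have hmax : P.IsMaximal :=
        Ideal.Quotient.maximal_of_isField P (IsArtinianRing.isField_of_isDomain _)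
      rwa [← hmax.eq_of_le hQp.ne_top hPQ]
    · have hyQ : y ∈ Q := hQ.1.2 (Ideal.mem_sup_right (Ideal.mem_span_singleton_self y))
      have hyP := h P hP hfin
      let t' : A ⧸ P := Ideal.Quotient.factorₐ k hP.1.2 t
      have : Module.Finite (Algebra.adjoin k {t'}) (A ⧸ P) :=
        .of_adjoin_of_surjective (s := {t}) (Ideal.Quotient.factorₐ k hP.1.2)
          (Ideal.Quotient.factor_surjective hP.1.2) _ (by
            rintro _ rfl
            exact Algebra.self_mem_adjoin_singleton k t')
      have := Ring.DimensionLEOne.of_finite_adjoin_singleton (k := k) t'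
      have hcomap : (Q.map (Ideal.Quotient.mk P)).comap (Ideal.Quotient.mk P) = Q := by
        rw [Ideal.comap_map_of_surjective' _ Ideal.Quotient.mk_surjective, Ideal.mk_ker,
          sup_eq_left.2 hPQ]
      have hprime : (Q.map (Ideal.Quotient.mk P)).IsPrime :=
        Ideal.map_isPrime_of_surjective Ideal.Quotient.mk_surjective (by rwa [Ideal.mk_ker])
      have hne : Q.map (Ideal.Quotient.mk P) ≠ ⊥ := by
        intro h0
        have := Ideal.mem_map_of_mem (Ideal.Quotient.mk P) hyQ
        rw [h0, Ideal.mem_bot, Ideal.Quotient.eq_zero_iff_mem] at this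
        exact hyP this
      have hm := Ring.DimensionLEOne.maximalOfPrime hne hprime
      rw [← hcomap]
      exact Ideal.comap_isMaximal_of_surjective _ Ideal.Quotient.mk_surjective

/-! ### Zariski-closed sets -/

/-- The set of points at which a vector-valued polynomial takes values in a given subspace is
Zariski closed. -/
theorem isZariskiClosed_setOf_sum_eval_smul_mem {k σ ι E : Type*} [Field k] [Fintype ι]
    [AddCommGroup E] [Module k E] (p : ι → MvPolynomial σ k) (v : ι → E) (V : Submodule k E) :
    IsZariskiClosed {C : σ → k | ∑ i, MvPolynomial.eval C (p i) • v i ∈ V} := by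
  -- One equation per linear functional on `E ⧸ V`; functionals separate points.
  refine ⟨Ideal.span (Set.range fun φ : Module.Dual k (E ⧸ V) => ∑ i, φ (V.mkQ (v i)) • p i), ?_⟩
  ext C
  rw [MvPolynomial.zeroLocus_span, Set.mem_ofPred_eq, Set.mem_ofPred_eq, Set.forall_mem_range,
    ← Submodule.Quotient.mk_eq_zero V, ← Module.forall_dual_apply_eq_zero_iff k]
  refine forall_congr' fun φ => ?_
  have : φ (V.mkQ (∑ i, MvPolynomial.eval C (p i) • v i))
      = MvPolynomial.aeval C (∑ i, φ (V.mkQ (v i)) • p i) := by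
    simp [map_sum, MvPolynomial.aeval_eq_eval, mul_comm]
  rw [← this]
  rfl

/-- Over an infinite field, a finite union of proper Zariski-closed subsets of affine space is a
proper Zariski-closed subset. -/
theorem IsZariskiClosed.biUnion_ne_univ {k σ ι : Type*} [Field k] [Infinite k] (s : Finset ι)
    (M : ι → Set (σ → k)) (hM : ∀ i ∈ s, IsZariskiClosed (M i)) (hne : ∀ i ∈ s, M i ≠ Set.univ) :
    IsZariskiClosed (⋃ i ∈ s, M i) ∧ ⋃ i ∈ s, M i ≠ Set.univ := by
  classical
  choose! I hI using hM
  have hmem : ∀ (J : Ideal (MvPolynomial σ k)) (C : σ → k),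
      C ∈ MvPolynomial.zeroLocus k J ↔ J ≤ RingHom.ker (MvPolynomial.eval C) := fun J C => by
    simp [SetLike.le_def, MvPolynomial.mem_zeroLocus_iff, MvPolynomial.aeval_eq_eval]
  have hU : ⋃ i ∈ s, M i = MvPolynomial.zeroLocus k (∏ i ∈ s, I i) := by
    ext C
    have hp : (RingHom.ker (MvPolynomial.eval C)).IsPrime := RingHom.ker_isPrime _
    simp only [Set.mem_iUnion, hmem, hp.prod_le, exists_prop]
    exact exists_congr fun i => and_congr_right fun hi => by rw [hI i hi, hmem]
  refine ⟨⟨_, hU⟩, fun h => ?_⟩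
  -- A polynomial vanishing everywhere over an infinite field is zero, so one factor `I i` must be
  -- zero.
  have h0 : ∏ i ∈ s, I i = ⊥ := by
    refine (Submodule.eq_bot_iff _).2 fun p hp => MvPolynomial.funext fun C => ?_
    have hC : C ∈ MvPolynomial.zeroLocus k (∏ i ∈ s, I i) := hU ▸ h ▸ Set.mem_univ C
    simpa using (hmem _ C).1 hC hp
  obtain ⟨i, hi, hi0⟩ := Finset.prod_eq_zero_iff.1 h0
  refine hne i hi ?_
  rw [hI i hi, hi0]
  exact MvPolynomial.zeroLocus_bot

/-! ### The `ℕ`-grading of the diagonal subring -/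

section DiagonalGrading

variable {k S : Type*} [Field k] [CommRing S] [Algebra k S] {n : ℕ}
  (𝒜 : (Fin n → ℕ) → Submodule k S)

/-- The component of degree `m` of the diagonal subring, consisting of its elements of degree
`(m, …, m)`. -/
def diagonalComponent (m : ℕ) : Submodule k (diagonalSubring 𝒜) :=
  (𝒜 fun _ => m).comap (diagonalSubring 𝒜).val.toLinearMap

instance diagonalComponent_gradedMonoid [GradedAlgebra 𝒜] :
    SetLike.GradedMonoid (diagonalComponent 𝒜) where
  one_mem := SetLike.GradedOne.one_mem (A := 𝒜)
  mul_mem i j _ _ ha hb :=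
    SetLike.GradedMul.mul_mem (A := 𝒜) (i := fun _ => i) (j := fun _ => j) ha hb

theorem iSup_diagonalComponent [GradedAlgebra 𝒜] : ⨆ m, diagonalComponent 𝒜 m = ⊤ := by
  have hmul : (⨆ m, diagonalComponent 𝒜 m) * (⨆ m, diagonalComponent 𝒜 m)
      ≤ ⨆ m, diagonalComponent 𝒜 m := by
    simp only [Submodule.iSup_mul, Submodule.mul_iSup]
    exact iSup_le fun i => iSup_le fun j => (Submodule.mul_le.2 fun a ha b hb =>
      Submodule.mem_iSup_of_mem _ (SetLike.mul_mem_graded ha hb))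
  refine eq_top_iff.2 fun a _ => ?_
  have ha : a ∈ Algebra.adjoin k ((↑) ⁻¹' (𝒜 1 : Set S) : Set (diagonalSubring 𝒜)) := by
    have h : Algebra.adjoin k ((↑) ⁻¹' (𝒜 1 : Set S) : Set (diagonalSubring 𝒜)) = ⊤ :=
      Algebra.adjoin_adjoin_coe_preimage
    exact h ▸ Algebra.mem_top
  clear * - ha hmul
  induction ha using Algebra.adjoin_induction with
  | mem x hx => exact Submodule.mem_iSup_of_mem 1 hx
  | algebraMap r =>
    rw [Algebra.algebraMap_eq_smul_one]
    exact Submodule.smul_mem _ r (Submodule.mem_iSup_of_mem 0 (SetLike.GradedOne.one_mem))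
  | add x y _ _ hx hy => exact add_mem hx hy
  | mul x y _ _ hx hy => exact hmul (Submodule.mul_mem_mul hx hy)

/-- Independence is inherited from `𝒜` along `m ↦ (m, …, m)`, which is injective only when `n ≠ 0`.
-/
theorem isInternal_diagonalComponent [NeZero n] [GradedAlgebra 𝒜] :
    DirectSum.IsInternal (diagonalComponent 𝒜) := by
  rw [DirectSum.isInternal_submodule_iff_iSupIndep_and_iSup_eq_top]
  refine ⟨iSupIndep_def.2 fun i => Submodule.disjoint_def.2 fun a ha ha' => ?_,
    iSup_diagonalComponent 𝒜⟩
  have hind : iSupIndep fun m : ℕ => 𝒜 fun _ => m :=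
    ((DirectSum.Decomposition.isInternal 𝒜).submodule_iSupIndep).comp
      (f := fun (m : ℕ) (_ : Fin n) => m) fun m m' h => congrFun h 0
  have hmap := Submodule.mem_map_of_mem (f := (diagonalSubring 𝒜).val.toLinearMap) ha'
  simp only [Submodule.map_iSup] at hmap
  exact Subtype.ext (Submodule.disjoint_def.1 (iSupIndep_def.1 hind i) _ ha
    (iSup₂_mono (fun j _ => Submodule.map_comap_le _ _) hmap))

end DiagonalGrading

/-! ### Complete reductions and the exchanged column -/

section CompleteReduction

variable {k S : Type*} [Field k] [CommRing S] [Algebra k S] {n r d : ℕ}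
  {𝒜 : (Fin n → ℕ) → Submodule k S} [GradedAlgebra 𝒜]

/-- A matrix is a complete reduction if and only if the ideal generated by its column products has
finite colength in the diagonal subring. -/
theorem isCompleteReduction_iff_finite_quotient [NeZero n]
    (x : ∀ i : Fin n, Fin r → 𝒜 (Pi.single i 1)) :
    IsCompleteReduction 𝒜 x ↔
      Module.Finite k (diagonalSubring 𝒜 ⧸ Ideal.span (Set.range (columnProd 𝒜 x))) := by
  constructor
  · intro (_ : Module.Finite _ _)
    exact .quotient_of_adjoin (s := Set.range (columnProd 𝒜 x)) Ideal.subset_span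
  · intro _
    let _ := (isInternal_diagonalComponent 𝒜).chooseDecomposition
    have : GradedAlgebra (diagonalComponent 𝒜) := { }
    refine finite_adjoin_range_of_finite_quotient (diagonalComponent 𝒜) fun j => ?_
    have h := SetLike.prod_mem_graded (A := 𝒜) (fun i : Fin n => Pi.single i 1)
      (fun i => (x i j : S)) (F := Finset.univ) (fun i _ => (x i j).2)
    have e : (∑ i : Fin n, (Pi.single i 1 : Fin n → ℕ)) = 1 :=
      Finset.univ_sum_single (1 : Fin n → ℕ)
    rw [e] at h
    exact h

/-- Makes the diagonal subring Noetherian, so that `J` has finitely many minimal primes. -/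
theorem IsCompleteReduction.finiteType {x : ∀ i : Fin n, Fin r → 𝒜 (Pi.single i 1)}
    (hx : IsCompleteReduction 𝒜 x) : Algebra.FiniteType k (diagonalSubring 𝒜) := by
  have : Module.Finite (Algebra.adjoin k (Set.range (columnProd 𝒜 x))) (diagonalSubring 𝒜) := hx
  have : Algebra.FiniteType k (Algebra.adjoin k (Set.range (columnProd 𝒜 x))) :=
    (Subalgebra.fg_iff_finiteType _).1 (Subalgebra.fg_def.2 ⟨_, Set.finite_range _, rfl⟩)
  exact .trans this inferInstance

/-- If `n = 0`, then the diagonal subring of a standard graded algebra is the base field. -/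
theorem IsStandardGraded.isCompleteReduction_of_eq_zero (hS : IsStandardGraded 𝒜) (hn : n = 0)
    (x : ∀ i : Fin n, Fin r → 𝒜 (Pi.single i 1)) : IsCompleteReduction 𝒜 x := by
  subst hn
  have htop : ∀ a : S, a ∈ 𝒜 0 := fun a => by
    classical
    rw [← DirectSum.sum_support_decompose 𝒜 a]
    exact sum_mem fun m _ => Subsingleton.elim m 0 ▸ SetLike.coe_mem _
  have : Module.Finite k (diagonalSubring 𝒜) :=
    Module.Finite.of_surjective (Algebra.linearMap k (diagonalSubring 𝒜)) fun a => by
      obtain ⟨c, hc⟩ := hS.degree_zero.2 ⟨a, htop a⟩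
      have h : algebraMap k S c = a := congrArg Subtype.val hc
      exact ⟨c, Subtype.ext h⟩
  exact Module.Finite.of_restrictScalars_finite k _ _

/-- The ideal generated by the products of all columns but the last. -/
def initColumnIdeal (x : ∀ i : Fin n, Fin d → 𝒜 (Pi.single i 1)) : Ideal (diagonalSubring 𝒜) :=
  Ideal.span (columnProd 𝒜 x '' {j | (j : ℕ) + 1 < d})

theorem span_range_columnProd_exchangeLast (x w : ∀ i : Fin n, Fin d → 𝒜 (Pi.single i 1))
    (C : Fin n × Fin d → k) {l : Fin d} (hl : (l : ℕ) + 1 = d) :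
    Ideal.span (Set.range (columnProd 𝒜 (exchangeLast 𝒜 x w C))) =
      initColumnIdeal x ⊔ Ideal.span {columnProd 𝒜 (exchangeLast 𝒜 x w C) l} := by
  rw [initColumnIdeal, ← Ideal.span_union]
  congr 1
  have hinit : ∀ j : Fin d, (j : ℕ) + 1 < d →
      columnProd 𝒜 (exchangeLast 𝒜 x w C) j = columnProd 𝒜 x j := fun j hj => by
    simp [columnProd, exchangeLast, hj]
  ext a
  constructor
  · rintro ⟨j, rfl⟩
    by_cases hj : (j : ℕ) + 1 < d
    · exact .inl ⟨j, hj, (hinit j hj).symm⟩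
    · exact .inr (by rw [show j = l from Fin.ext (by omega)]; rfl)
  · rintro (⟨j, hj, rfl⟩ | rfl)
    · exact ⟨j, hinit j hj⟩
    · exact ⟨l, rfl⟩

/-- The last column product of the exchanged matrix, expanded multilinearly. -/
theorem columnProd_exchangeLast_last (x w : ∀ i : Fin n, Fin d → 𝒜 (Pi.single i 1))
    (C : Fin n × Fin d → k) {l : Fin d} (hl : (l : ℕ) + 1 = d) :
    columnProd 𝒜 (exchangeLast 𝒜 x w C) l =
      ∑ f : Fin n → Fin d, MvPolynomial.eval C (∏ i, MvPolynomial.X (i, f i)) •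
        (⟨∏ i, (w i (f i) : S), prod_mem_diagonalSubring 𝒜 fun i => w i (f i)⟩ :
          diagonalSubring 𝒜) := by
  refine Subtype.ext ?_
  rw [AddSubmonoidClass.coe_finsetSum]
  simp only [columnProd, exchangeLast, hl, lt_irrefl, if_false, Submodule.coe_sum,
    Submodule.coe_smul, Subalgebra.coe_smul, map_prod, MvPolynomial.eval_X]
  rw [Finset.prod_univ_sum, Fintype.piFinset_univ]
  exact Finset.sum_congr rfl fun f _ => Finset.prod_smul _ _ _

/-- The coefficient matrix supported on the `j`-th column selects the `j`-th column product of the second matrix. -/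
theorem columnProd_exchangeLast_single (x w : ∀ i : Fin n, Fin d → 𝒜 (Pi.single i 1))
    (j : Fin d) {l : Fin d} (hl : (l : ℕ) + 1 = d) :
    columnProd 𝒜 (exchangeLast 𝒜 x w fun p => if p.2 = j then 1 else 0) l = columnProd 𝒜 w j := by
  simp [columnProd, exchangeLast, hl]

end CompleteReduction

theorem theorem5p1 {k S : Type*} [Field k] [Infinite k] [CommRing S] [Algebra k S] {n d : ℕ}
    (𝒜 : (Fin n → ℕ) → Submodule k S) [GradedAlgebra 𝒜] (hS : IsStandardGraded 𝒜)
    (hd : 1 ≤ d) (hdim : ringKrullDim (diagonalSubring 𝒜) = (d : WithBot ℕ∞))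
    (x w : ∀ i : Fin n, Fin d → 𝒜 (Pi.single i 1))
    (hx : IsCompleteReduction 𝒜 x) (hw : IsCompleteReduction 𝒜 w) :
    ∃ M : Set (Fin n × Fin d → k), IsZariskiClosed M ∧ M ≠ Set.univ ∧
      ∀ C : Fin n × Fin d → k,
        C ∉ M ↔ IsCompleteReduction 𝒜 (exchangeLast 𝒜 x w C) := by
  classical
  rcases Nat.eq_zero_or_pos n with hn | hn
  -- For `n = 0` every matrix is a complete reduction, so nothing is excluded.
  · exact ⟨∅, ⟨⊤, MvPolynomial.zeroLocus_top.symm⟩, Set.empty_ne_univ, fun C =>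
      iff_of_true (Set.notMem_empty C) (hS.isCompleteReduction_of_eq_zero hn _)⟩
  have : NeZero n := ⟨hn.ne'⟩
  obtain ⟨l, hl⟩ : ∃ l : Fin d, (l : ℕ) + 1 = d := ⟨⟨d - 1, by omega⟩, Nat.sub_add_cancel hd⟩
  have := hx.finiteType
  have : IsNoetherianRing (diagonalSubring 𝒜) := Algebra.FiniteType.isNoetherianRing k _
  set J := initColumnIdeal x
  let t := Ideal.Quotient.mk J (columnProd 𝒜 x l)
  have : Module.Finite (Algebra.adjoin k {t}) (diagonalSubring 𝒜 ⧸ J) := by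
    have : Module.Finite (Algebra.adjoin k (Set.range (columnProd 𝒜 x))) (diagonalSubring 𝒜) := hx
    refine .of_adjoin_of_surjective (s := Set.range (columnProd 𝒜 x)) (Ideal.Quotient.mkₐ k J)
      (Ideal.Quotient.mkₐ_surjective k J) _ ?_
    rintro _ ⟨j, rfl⟩
    by_cases hj : (j : ℕ) + 1 < d
    · have : Ideal.Quotient.mkₐ k J (columnProd 𝒜 x j) = 0 :=
        Ideal.Quotient.eq_zero_iff_mem.2 (Ideal.subset_span ⟨j, hj, rfl⟩)
      rw [this]
      exact zero_mem _
    · rw [show j = l from Fin.ext (by omega)]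
      exact Algebra.self_mem_adjoin_singleton k t
  let s := (Ideal.finite_minimalPrimes_of_isNoetherianRing _ J).toFinset.filter
    fun P => ¬ Module.Finite k (diagonalSubring 𝒜 ⧸ P)
  let Z : Ideal (diagonalSubring 𝒜) → Set (Fin n × Fin d → k) := fun P =>
    {C | columnProd 𝒜 (exchangeLast 𝒜 x w C) l ∈ P}
  have hclosed : ∀ P ∈ s, IsZariskiClosed (Z P) := fun P _ => by
    simp only [Z, columnProd_exchangeLast_last x w _ hl]
    exact isZariskiClosed_setOf_sum_eval_smul_mem _ _ (P.restrictScalars k)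
  have hproper : ∀ P ∈ s, Z P ≠ Set.univ := fun P hP h => by
    have : Module.Finite (Algebra.adjoin k (Set.range (columnProd 𝒜 w))) (diagonalSubring 𝒜) := hw
    refine (Finset.mem_filter.1 hP).2
      (.quotient_of_adjoin (s := Set.range (columnProd 𝒜 w)) ?_)
    rintro _ ⟨j, rfl⟩
    -- If `Z P` were everything, testing it on the indicator of column `j` would put each `W_j` in
    -- `P`.
    have hj : (fun p => if p.2 = j then 1 else 0) ∈ Z P := h ▸ Set.mem_univ _
    rwa [Set.mem_ofPred_eq, columnProd_exchangeLast_single x w j hl] at hj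
  obtain ⟨hM, hMne⟩ := IsZariskiClosed.biUnion_ne_univ s Z hclosed hproper
  refine ⟨_, hM, hMne, fun C => ?_⟩
  rw [isCompleteReduction_iff_finite_quotient, span_range_columnProd_exchangeLast x w C hl,
    finite_quotient_sup_span_singleton_iff t]
  simp [s, Z, J]
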